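/- Let $d\in\mathbb N$ and let $K:\mathbb R^d\times\mathbb R^d\to\mathbb R$ be a shift-invariant kernel (that is, $K(x,y)$ depends only on $x-y$) such that $k(z):=K(z,0)$ is real-analytic in a neighbourhood of the origin. Then there are constants $C_1,C_2>0$, depending only on $K$, such that the following holds. Let $\varphi:\mathbb R^d\to\mathcal H$ be any feature mapping of $K$, i.e. $\mathcal H$ is a real inner product space and $\langle\varphi(x),\varphi(y)\rangle=K(x,y)$ for all $x,y$, and write $\mathrm{dist}_\varphi(x,y)=\|\varphi(x)-\varphi(y)\|$. Let $0<\delta\le\varepsilon\le 2^{-16}$ and let $D\in\mathbb N$ satisfy $$D\ \ge\ \max\bigl\{C_1\,\varepsilon^{-1}\log^3(1/\delta),\ C_2\,\varepsilon^{-2}\log(1/\delta)\bigr\}.$$ Let $\omega_1,\dots,\omega_D$ be i.i.d. random vectors in $\mathbb R^d$ whose distribution has a density $p$ with respect to Lebesgue measure, where $p$ is the Fourier transform of the normalized kernel, $$p(\omega)=\frac1{(2\pi)^d}\int_{\mathbb R^d}\frac{k(x)}{k(0)}\,e^{-\mathrm i\langle\omega,x\rangle}\,dx$$ (understood in the sense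 of tempered distributions if $k$ is not integrable), and let $$\pi(x)=\sqrt{\tfrac{k(0)}{D}}\,\bigl(\sin\langle\omega_1,x\rangle,\cos\langle\omega_1,x\rangle,\dots,\sin\langle\omega_D,x\rangle,\cos\langle\omega_D,x\rangle\bigr)$$ be the random Fourier feature (RFF) map of $K$, with $\mathrm{dist}_\pi(x,y)=\|\pi(x)-\pi(y)\|_2$. Then for every $x,y\in\mathbb R^d$, $$\Pr\bigl[\,|\mathrm{dist}_\pi(x,y)-\mathrm{dist}_\varphi(x,y)|\le\varepsilon\cdot\mathrm{dist}_\varphi(x,y)\,\bigr]\ \ge\ 1-\delta .$$ -/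

import Mathlib

open MeasureTheory ProbabilityTheory
open scoped ENNReal

noncomputable section

/-- A kernel on `ℝ^d` is shift-invariant if `K x y` depends only on `x - y`. -/
def IsShiftInvariant {d : ℕ}
    (K : EuclideanSpace ℝ (Fin d) → EuclideanSpace ℝ (Fin d) → ℝ) : Prop :=
  ∃ k : EuclideanSpace ℝ (Fin d) → ℝ, ∀ x y, K x y = k (x - y)

/-- `φ` is a feature mapping of the kernel `K`: the kernel is the inner product of features. -/
def IsFeatureMap {d : ℕ} {H : Type*} [NormedAddCommGroup H] [InnerProductSpace ℝ H]
    (K : EuclideanSpace ℝ (Fin d) → EuclideanSpace ℝ (Fin d) → ℝ)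
    (φ : EuclideanSpace ℝ (Fin d) → H) : Prop :=
  ∀ x y, inner ℝ (φ x) (φ y) = K x y

/-- The unnormalized Fourier integral `∫ f(ω) exp(-i⟨ω, x⟩) dω`. -/
def fourierInt {d : ℕ} (f : EuclideanSpace ℝ (Fin d) → ℂ) (x : EuclideanSpace ℝ (Fin d)) : ℂ :=
  ∫ ω, f ω * Complex.exp (-(Complex.I * ((inner ℝ ω x : ℝ) : ℂ)))

/-- `μ` is the spectral distribution of the shift-invariant kernel `K`: it has a density `p`
with respect to Lebesgue measure, and `p` is the Fourier transform
`p(ω) = (2π)^(-d) ∫ k(x) exp(-i⟨ω, x⟩) dx` of the normalized profile `k(x) = K(x, 0) / K(0, 0)`.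
As `k` need not be integrable, the Fourier transform is the one of tempered distributions:
`∫ p(ω) f(ω) dω = (2π)^(-d) ∫ k(x) (∫ f(ω) exp(-i⟨ω, x⟩) dω) dx` for all Schwartz functions `f`.
For integrable `k` this is the same, by Fubini, as the pointwise formula almost everywhere. -/
structure IsSpectralDistribution {d : ℕ}
    (K : EuclideanSpace ℝ (Fin d) → EuclideanSpace ℝ (Fin d) → ℝ)
    (μ : Measure (EuclideanSpace ℝ (Fin d))) : Prop where
  absolutelyContinuous : μ ≪ volume
  fourier : ∀ f : SchwartzMap (EuclideanSpace ℝ (Fin d)) ℂ,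
    ∫ ω, f ω ∂μ =
      (((2 * Real.pi) ^ d : ℝ) : ℂ)⁻¹ * ∫ x, ((K x 0 / K 0 0 : ℝ) : ℂ) * fourierInt f x

/-- `ω₁, …, ω_D` are i.i.d. samples from the spectral distribution of `K`. -/
structure IsRFFSample {d D : ℕ} {Ω : Type*} [MeasurableSpace Ω]
    (K : EuclideanSpace ℝ (Fin d) → EuclideanSpace ℝ (Fin d) → ℝ)
    (P : Measure Ω) (ω : Fin D → Ω → EuclideanSpace ℝ (Fin d)) : Prop where
  indep : iIndepFun ω P
  law : ∃ μ, IsSpectralDistribution K μ ∧ ∀ i, HasLaw (ω i) μ P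

/-- The random Fourier feature map with frequencies `w₁, …, w_D`, for a kernel with
`K(x, x) = κ`: the vector `√(κ / D) (sin⟨w₁, x⟩, cos⟨w₁, x⟩, …, sin⟨w_D, x⟩, cos⟨w_D, x⟩)`.
For a normalized kernel, `κ = 1`. -/
def rffMap {d D : ℕ} (κ : ℝ) (w : Fin D → EuclideanSpace ℝ (Fin d))
    (x : EuclideanSpace ℝ (Fin d)) : EuclideanSpace ℝ (Fin D × Fin 2) :=
  WithLp.toLp 2 fun j =>
    √(κ / D) * (if j.2 = 0 then Real.sin (inner ℝ (w j.1) x) else Real.cos (inner ℝ (w j.1) x))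

end

/-! Put z = x - y and m(z) = E(1 - cos⟨ω, z⟩) = 1 - k(z)/k(0). The ratio of squared distances, RFF
over kernel, is the empirical mean of the variables W_i = (1 - cos⟨ω_i, z⟩)/m(z), which have mean 1.
So the claim is concentration of this mean, with constants that do not depend on z.

Uniformity in z comes from √W ≤ 2 + 2R‖ω‖. The numerator is at most min(2, ‖ω‖²‖z‖²/2), and m(z) ≥
min(1/2, ‖z‖²/(8R²)): for large z by Riemann-Lebesgue, since ω has a density, and for smaller z by
the doubling inequality m(2z) ≤ 4m(z) (`exists_min_le_integral_one_sub_cos`). Analyticity of k at 0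
gives ‖ω‖ an exponential moment, because the even moments of each coordinate are bounded by Taylor
coefficients (`lintegral_pow_le_of_hasFPowerSeriesAt`). Hence E exp(r√W) ≤ M for all z ≠ 0.

Such W has tails of order exp(-r√w). With L = log(1/δ), truncating at T of order L² leaves an excess
of mean O(δ²), handled by Markov's inequality. Bernstein's inequality for the truncated variables
needs D of order TL/ε + L/ε², which is the stated bound (`measure_abs_sum_sub_card_gt_le`). -/

theorem exp_le_one_add_add_sq {x : ℝ} (hx : |x| ≤ 1) : Real.exp x ≤ 1 + x + x ^ 2 := by
  have := abs_le.1 (Real.abs_exp_sub_one_sub_id_le hx)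
  linarith [this.2]

/-- The mean excess over a level of a random variable with a stretched exponential moment. -/
theorem integral_sub_min_le {Ω : Type*} [MeasurableSpace Ω] {P : Measure Ω} {W : Ω → ℝ} {s M R : ℝ} (hs : 0 < s) (h0 : ∀ x, 0 ≤ W x)
    (hexp : Integrable (fun x => Real.exp (s * √(W x))) P)
    (hM : ∫ x, Real.exp (s * √(W x)) ∂P ≤ M) :
    ∫ x, (W x - min (W x) (R ^ 2)) ∂P ≤ 8 / s ^ 2 * M * Real.exp (-(s * R / 2)) := by
  have key : ∀ x, W x - min (W x) (R ^ 2) ≤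
      8 / s ^ 2 * Real.exp (-(s * R / 2)) * Real.exp (s * √(W x)) := by
    intro x
    rcases le_total (W x) (R ^ 2) with h | h
    · rw [min_eq_left h, sub_self]; positivity
    · rw [min_eq_right h]
      have hr : R ≤ √(W x) := Real.le_sqrt_of_sq_le h
      set r := √(W x)
      have hr0 : 0 ≤ r := Real.sqrt_nonneg _
      have hWr : W x = r ^ 2 := (Real.sq_sqrt (h0 x)).symm
      -- Half of the exponent s * r absorbs the quadratic factor; the other half gives the decay in
      -- R.
      have h1 : (s * r / 2) ^ 2 / 2 ≤ Real.exp (s * r / 2) := by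
        have := Real.quadratic_le_exp_of_nonneg (x := s * r / 2) (by positivity)
        have : 0 ≤ s * r / 2 := by positivity
        linarith
      have h2 : Real.exp (s * r / 2) ≤ Real.exp (-(s * R / 2)) * Real.exp (s * r) := by
        rw [← Real.exp_add, Real.exp_le_exp]
        nlinarith
      calc W x - R ^ 2 ≤ 8 / s ^ 2 * ((s * r / 2) ^ 2 / 2) := by
            rw [hWr]; field_simp; nlinarith [sq_nonneg R, sq_nonneg s]
        _ ≤ 8 / s ^ 2 * (Real.exp (-(s * R / 2)) * Real.exp (s * r)) := by
            gcongr; exact h1.trans h2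
        _ = _ := by ring
  calc ∫ x, (W x - min (W x) (R ^ 2)) ∂P
      ≤ ∫ x, 8 / s ^ 2 * Real.exp (-(s * R / 2)) * Real.exp (s * √(W x)) ∂P :=
        integral_mono_of_nonneg (ae_of_all _ fun x => sub_nonneg.2 (min_le_left _ _))
          (hexp.const_mul _) (ae_of_all _ key)
    _ = 8 / s ^ 2 * Real.exp (-(s * R / 2)) * ∫ x, Real.exp (s * √(W x)) ∂P := by
        rw [integral_const_mul]
    _ ≤ 8 / s ^ 2 * Real.exp (-(s * R / 2)) * M := by gcongr
    _ = _ := by ring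

/-! ### Concentration for stretched exponential tails -/

section Concentration

variable {Ω : Type*} [MeasurableSpace Ω] {P : Measure Ω} [IsProbabilityMeasure P]

/-- A bounded nonnegative random variable has a sub-exponential centred moment generating
function. -/
theorem mgf_sub_integral_le {V : Ω → ℝ} {T v t : ℝ} (hV : AEMeasurable V P)
    (h0 : ∀ s, 0 ≤ V s) (hT : ∀ s, V s ≤ T) (hv : ∫ s, V s ^ 2 ∂P ≤ v) (ht : |t| * T ≤ 1) :
    mgf (fun s => V s - ∫ r, V r ∂P) P t ≤ Real.exp (t ^ 2 * v) := by
  have hint : Integrable V P :=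
    Integrable.of_mem_Icc 0 T hV (ae_of_all _ fun s => ⟨h0 s, hT s⟩)
  have hint2 : Integrable (fun s => V s ^ 2) P :=
    Integrable.of_mem_Icc 0 (T ^ 2) (hV.pow_const 2)
      (ae_of_all _ fun s => ⟨sq_nonneg _, pow_le_pow_left₀ (h0 s) (hT s) 2⟩)
  set m := ∫ r, V r ∂P
  have hle : ∀ s, Real.exp (t * (V s - m)) ≤
      Real.exp (-(t * m)) * (1 + t * V s + t ^ 2 * V s ^ 2) := by
    intro s
    have h1 : |t * V s| ≤ 1 := by
      rw [abs_mul, abs_of_nonneg (h0 s)]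
      exact (mul_le_mul_of_nonneg_left (hT s) (abs_nonneg t)).trans ht
    have h2 : t * (V s - m) = -(t * m) + t * V s := by ring
    rw [h2, Real.exp_add]
    have := exp_le_one_add_add_sq h1
    rw [mul_pow] at this
    gcongr
  have hi1 : Integrable (fun s => 1 + t * V s) P := (integrable_const 1).add (hint.const_mul t)
  have hi2 : Integrable (fun s => t ^ 2 * V s ^ 2) P := hint2.const_mul _
  calc mgf (fun s => V s - m) P t
      ≤ ∫ s, Real.exp (-(t * m)) * (1 + t * V s + t ^ 2 * V s ^ 2) ∂P :=
        integral_mono_of_nonneg (ae_of_all _ fun s => (Real.exp_pos _).le)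
          ((hi1.add hi2).const_mul _) (ae_of_all _ hle)
    _ = Real.exp (-(t * m)) * (1 + t * m + t ^ 2 * ∫ s, V s ^ 2 ∂P) := by
        rw [integral_const_mul, integral_add hi1 hi2, integral_add (integrable_const 1)
          (hint.const_mul t), integral_const_mul, integral_const_mul]
        simp [m]
    -- By 1 + u ≤ exp u; the linear term then cancels the centring factor.
    _ ≤ Real.exp (-(t * m)) * Real.exp (t * m + t ^ 2 * v) := by
        gcongr
        have : t ^ 2 * ∫ s, V s ^ 2 ∂P ≤ t ^ 2 * v := by gcongr
        linarith [Real.add_one_le_exp (t * m + t ^ 2 * v)]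
    _ = Real.exp (t ^ 2 * v) := by rw [← Real.exp_add]; ring_nf

/-- **Bernstein's inequality** for sums of independent random variables in `[0, T]`, with a free
parameter `t`. -/
theorem measure_abs_sum_sub_integral_ge_le {ι : Type*} [Fintype ι] {V : ι → Ω → ℝ} {T v t η : ℝ}
    (hind : iIndepFun V P) (hV : ∀ i, AEMeasurable (V i) P) (h0 : ∀ i s, 0 ≤ V i s)
    (hT : ∀ i s, V i s ≤ T) (hv : ∀ i, ∫ s, V i s ^ 2 ∂P ≤ v) (ht0 : 0 ≤ t) (htT : t * T ≤ 1)
    (htv : t * v ≤ η / 2) :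
    P.real {s | Fintype.card ι * η ≤ |∑ i, (V i s - ∫ r, V i r ∂P)|} ≤
      2 * Real.exp (-(Fintype.card ι * (t * η / 2))) := by
  set X : ι → Ω → ℝ := fun i s => V i s - ∫ r, V i r ∂P with hX
  have hXind : iIndepFun X P :=
    hind.comp (fun i x => x - ∫ r, V i r ∂P) fun i => by fun_prop
  have hXm : ∀ i, AEMeasurable (X i) P := fun i => (hV i).sub_const _
  have hmgf : ∀ u : ℝ, |u| = t → mgf (∑ i, X i) P u ≤ Real.exp (Fintype.card ι * (t ^ 2 * v)) := by
    intro u hu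
    rw [hXind.mgf_sum₀ hXm, Real.exp_nat_mul]
    refine (Finset.prod_le_prod (fun _ _ => mgf_nonneg) (g := fun _ => Real.exp (t ^ 2 * v))
      fun i _ => ?_).trans (by simp)
    have := mgf_sub_integral_le (t := u) (hV i) (h0 i) (hT i) (hv i) (by rwa [hu])
    rwa [← sq_abs, hu] at this
  have hint : ∀ u : ℝ, Integrable (fun s => Real.exp (u * (∑ i, X i) s)) P := by
    intro u
    refine integrable_exp_mul_of_mem_Icc (a := ∑ i, -∫ r, V i r ∂P)
      (b := ∑ i, (T - ∫ r, V i r ∂P)) (Finset.aemeasurable_sum _ fun i _ => hXm i)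
      (ae_of_all _ fun s => ?_)
    rw [Finset.sum_apply]
    refine ⟨Finset.sum_le_sum fun i _ => ?_, Finset.sum_le_sum fun i _ => ?_⟩
    · simp only [hX]; linarith [h0 i s]
    · simp only [hX]; linarith [hT i s]
  -- Since t * v ≤ η / 2, the variance term costs at most half of the Chernoff exponent t * η.
  have hexp : Real.exp (-t * (Fintype.card ι * η)) * Real.exp (Fintype.card ι * (t ^ 2 * v)) ≤
      Real.exp (-(Fintype.card ι * (t * η / 2))) := by
    rw [← Real.exp_add, Real.exp_le_exp]
    have h1 : t * (t * v) ≤ t * (η / 2) := by gcongr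
    have h2 : (Fintype.card ι : ℝ) * (t * (t * v)) ≤ Fintype.card ι * (t * (η / 2)) := by gcongr
    linarith
  have hup := measure_ge_le_exp_mul_mgf (Fintype.card ι * η) ht0 (hint t)
  have hlo := measure_le_le_exp_mul_mgf (-(Fintype.card ι * η)) (neg_nonpos.2 ht0) (hint (-t))
  have h1 := mul_le_mul_of_nonneg_left (hmgf t (abs_of_nonneg ht0))
    (Real.exp_pos (-t * (Fintype.card ι * η))).le
  have h2 := mul_le_mul_of_nonneg_left (hmgf (-t) (by rw [abs_neg, abs_of_nonneg ht0]))
    (Real.exp_pos (-t * (Fintype.card ι * η))).le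
  have hsub : {s | Fintype.card ι * η ≤ |∑ i, (V i s - ∫ r, V i r ∂P)|} ⊆
      {s | Fintype.card ι * η ≤ (∑ i, X i) s} ∪ {s | (∑ i, X i) s ≤ -(Fintype.card ι * η)} := by
    intro s hs
    simp only [Set.mem_ofPred_eq, Set.mem_union, Finset.sum_apply, hX] at hs ⊢
    rcases le_abs.1 hs with h | h
    · exact Or.inl h
    · exact Or.inr (by linarith)
  refine (measureReal_mono hsub).trans ((measureReal_union_le _ _).trans ?_)
  have e : - -t * -(Fintype.card ι * η) = -t * (Fintype.card ι * η) := by ring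
  rw [e] at hlo
  linarith

/-- Concentration of the empirical mean of independent nonnegative random variables of mean `1`
with a stretched exponential moment. -/
theorem measure_abs_sum_sub_card_gt_le {ι : Type*} [Fintype ι] {W : ι → Ω → ℝ}
    {s M a v b ε δ : ℝ} (hs : 0 < s) (hM0 : 0 < M) (hb : 0 ≤ b)
    (hbM : 64 * M / s ^ 2 ≤ Real.exp b) (ha : a = 2 * (2 + b) / s) (hv : v = 24 / s ^ 4 * M)
    (hind : iIndepFun W P) (hW : ∀ i, AEMeasurable (W i) P) (h0 : ∀ i x, 0 ≤ W i x)
    (hmean : ∀ i, ∫ x, W i x ∂P = 1)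
    (hexp : ∀ i, Integrable (fun x => Real.exp (s * √(W i x))) P)
    (hM : ∀ i, ∫ x, Real.exp (s * √(W i x)) ∂P ≤ M)
    (hδ : 0 < δ) (hδε : δ ≤ ε) (hε : ε ≤ 1 / 2 ^ 16)
    (hD₁ : 8 * a ^ 2 * (ε⁻¹ * Real.log (1 / δ) ^ 3) ≤ Fintype.card ι)
    (hD₂ : 32 * v * ((ε ^ 2)⁻¹ * Real.log (1 / δ)) ≤ Fintype.card ι) :
    P.real {x | Fintype.card ι * ε < |∑ i, W i x - Fintype.card ι|} ≤ δ := by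
  set L := Real.log (1 / δ) with hL
  set D : ℝ := (Fintype.card ι : ℝ) with hD
  have hε0 : 0 < ε := hδ.trans_le hδε
  have hδ16 : δ ≤ 1 / 2 ^ 16 := hδε.trans hε
  have hexpL : Real.exp (-L) = δ := by
    rw [hL, one_div, Real.log_inv, neg_neg, Real.exp_log hδ]
  have hL1 : 1 ≤ L := by
    rw [hL, Real.le_log_iff_exp_le (by positivity)]
    have h1 : (3 : ℝ) ≤ 1 / δ := by
      rw [le_div_iff₀ hδ]; norm_num at hδ16 ⊢; linarith
    linarith [Real.exp_one_lt_d9]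
  have ha0 : 0 < a := by rw [ha]; positivity
  have hv0 : 0 < v := by rw [hv]; positivity
  have hD0 : 0 < D := lt_of_lt_of_le (by positivity) hD₁
  -- At √W = a * L, the excess bound decays like exp(-(2 + b)L) = δ² exp(-bL); as L ≥ 1, the second
  -- factor absorbs 64M/s².
  set T := (a * L) ^ 2 with hT
  have hT0 : 0 < T := by positivity
  set V : ι → Ω → ℝ := fun i x => min (W i x) T with hV
  have hVm : ∀ i, AEMeasurable (V i) P := fun i => (hW i).min aemeasurable_const
  have hV0 : ∀ i x, 0 ≤ V i x := fun i x => le_min (h0 i x) hT0.le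
  have hVW : ∀ i x, V i x ≤ W i x := fun i x => min_le_left _ _
  -- A non-integrable function has integral 0 by convention, so mean 1 forces integrability.
  have hWint : ∀ i, Integrable (W i) P := fun i => by
    by_contra h
    have := hmean i
    rw [integral_undef h] at this
    norm_num at this
  have hVint : ∀ i, Integrable (V i) P := fun i =>
    Integrable.of_mem_Icc 0 T (hVm i) (ae_of_all _ fun x => ⟨hV0 i x, min_le_right _ _⟩)
  have hVind : iIndepFun V P :=
    hind.comp (fun _ w => min w T) fun i => measurable_id.min measurable_const
  have hbias : ∀ i, ∫ x, (W i x - V i x) ∂P ≤ δ ^ 2 / 8 := by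
    intro i
    refine (integral_sub_min_le (R := a * L) hs (h0 i) (hexp i) (hM i)).trans ?_
    have e1 : s * (a * L) / 2 = (2 + b) * L := by rw [ha]; field_simp
    have e2 : Real.exp (-((2 + b) * L)) = δ ^ 2 * Real.exp (-(b * L)) := by
      rw [← hexpL, ← Real.exp_nat_mul, ← Real.exp_add]; push_cast; ring_nf
    have e3 : 64 * M / s ^ 2 * Real.exp (-(b * L)) ≤ 1 := by
      calc 64 * M / s ^ 2 * Real.exp (-(b * L)) ≤ Real.exp b * Real.exp (-(b * L)) := by gcongr
        _ = Real.exp (b - b * L) := by rw [← Real.exp_add]; ring_nf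
        _ ≤ 1 := Real.exp_le_one_iff.2 (by nlinarith)
    rw [e1, e2]
    calc 8 / s ^ 2 * M * (δ ^ 2 * Real.exp (-(b * L)))
        = δ ^ 2 / 8 * (64 * M / s ^ 2 * Real.exp (-(b * L))) := by ring
      _ ≤ δ ^ 2 / 8 * 1 := by gcongr
      _ = _ := mul_one _
  have hsecond : ∀ i, ∫ x, V i x ^ 2 ∂P ≤ v := by
    intro i
    calc ∫ x, V i x ^ 2 ∂P ≤ ∫ x, 24 / s ^ 4 * Real.exp (s * √(W i x)) ∂P := by
          refine integral_mono_of_nonneg (ae_of_all _ fun x => sq_nonneg _)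
            ((hexp i).const_mul _) (ae_of_all _ fun x => ?_)
          have h1 := Real.pow_div_factorial_le_exp (s * √(W i x)) (by positivity) 4
          have h2 : √(W i x) ^ 4 = W i x ^ 2 := by
            rw [show 4 = 2 * 2 from rfl, pow_mul, Real.sq_sqrt (h0 i x)]
          rw [mul_pow, h2] at h1
          calc V i x ^ 2 ≤ W i x ^ 2 := pow_le_pow_left₀ (hV0 i x) (hVW i x) 2
            _ = 24 / s ^ 4 * (s ^ 4 * W i x ^ 2 / (Nat.factorial 4 : ℕ)) := by
                simp only [Nat.factorial]; push_cast; field_simp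
            _ ≤ _ := mul_le_mul_of_nonneg_left h1 (by positivity)
      _ = 24 / s ^ 4 * ∫ x, Real.exp (s * √(W i x)) ∂P := integral_const_mul _ _
      _ ≤ v := by rw [hv]; gcongr; exact hM i
  -- The largest t allowed by Bernstein with η = ε / 2. The two terms of the minimum produce the two
  -- lower bounds on D.
  set t := min (1 / T) (ε / (4 * v)) with ht
  have hbern := measure_abs_sum_sub_integral_ge_le (η := ε / 2) (t := t) hVind hVm hV0
    (fun i x => min_le_right _ _) hsecond (by positivity)
    (by calc t * T ≤ 1 / T * T := by gcongr; exact min_le_left _ _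
          _ = 1 := by field_simp)
    (by calc t * v ≤ ε / (4 * v) * v := by gcongr; exact min_le_right _ _
          _ = ε / 2 / 2 := by field_simp; norm_num)
  have hrate : 2 * L ≤ D * (t * (ε / 2) / 2) := by
    rcases min_choice (1 / T) (ε / (4 * v)) with h | h
    · rw [ht, h]
      calc 2 * L = 8 * a ^ 2 * (ε⁻¹ * L ^ 3) * (1 / T * (ε / 2) / 2) := by
            rw [hT]; field_simp; norm_num
        _ ≤ _ := by gcongr
    · rw [ht, h]
      calc 2 * L = 32 * v * ((ε ^ 2)⁻¹ * L) * (ε / (4 * v) * (ε / 2) / 2) := by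
            field_simp; norm_num
        _ ≤ _ := by gcongr
  have hbern' : P.real {x | D * (ε / 2) ≤ |∑ i, (V i x - ∫ r, V i r ∂P)|} ≤ 2 * δ ^ 2 := by
    refine hbern.trans ?_
    rw [← hexpL, ← Real.exp_nat_mul]
    gcongr
    push_cast
    linarith
  have hmarkov : P.real {x | D * (ε / 4) ≤ ∑ i, (W i x - V i x)} ≤ δ / 2 := by
    have h1 := mul_meas_ge_le_integral_of_nonneg (μ := P) (f := fun x => ∑ i, (W i x - V i x))
      (ae_of_all _ fun x => Finset.sum_nonneg fun i _ => sub_nonneg.2 (hVW i x))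
      (integrable_finsetSum _ fun i _ => (hWint i).sub (hVint i)) (D * (ε / 4))
    have h1' : ∫ x, ∑ i, (W i x - V i x) ∂P = ∑ i, ∫ x, (W i x - V i x) ∂P :=
      integral_finsetSum _ fun i _ => (hWint i).sub (hVint i)
    rw [h1'] at h1
    have h2 : ∑ i, ∫ x, (W i x - V i x) ∂P ≤ D * (δ ^ 2 / 8) := by
      refine (Finset.sum_le_sum fun i _ => hbias i).trans (le_of_eq ?_)
      simp [hD]
    -- Here δ ≤ ε enters: a bias of order δ² survives division by the Markov threshold of order ε.
    have h3 : D * (δ ^ 2 / 8) ≤ D * (ε / 4) * (δ / 2) := by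
      have : D * (δ * δ) ≤ D * (ε * δ) := by gcongr
      linarith
    exact le_of_mul_le_mul_left (h1.trans (h2.trans h3)) (by positivity)
  -- The error budget is ε/2 for the truncated fluctuation, ε/4 for the excess and ε/4 for the mean
  -- of the excess.
  have hsub : {x | D * ε < |∑ i, W i x - D|} ⊆
      {x | D * (ε / 2) ≤ |∑ i, (V i x - ∫ r, V i r ∂P)|} ∪
        {x | D * (ε / 4) ≤ ∑ i, (W i x - V i x)} := by
    intro x hx
    simp only [Set.mem_ofPred_eq, Set.mem_union] at hx ⊢
    by_contra! h
    obtain ⟨h1, h2⟩ := h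
    have hdec : ∑ i, W i x - D = ∑ i, (V i x - ∫ r, V i r ∂P) + ∑ i, (W i x - V i x)
        - ∑ i, ∫ r, (W i r - V i r) ∂P := by
      have : ∑ i, ∫ r, (W i r - V i r) ∂P = D - ∑ i, ∫ r, V i r ∂P := by
        rw [hD, ← Finset.card_univ, Finset.card_eq_sum_ones]
        push_cast
        rw [← Finset.sum_sub_distrib]
        exact Finset.sum_congr rfl fun i _ => by rw [integral_sub (hWint i) (hVint i), hmean i]
      rw [this, Finset.sum_sub_distrib, Finset.sum_sub_distrib]
      ring
    have h3 : 0 ≤ ∑ i, (W i x - V i x) := Finset.sum_nonneg fun i _ => sub_nonneg.2 (hVW i x)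
    have h4 : 0 ≤ ∑ i, ∫ r, (W i r - V i r) ∂P := Finset.sum_nonneg fun i _ =>
      integral_nonneg fun r => sub_nonneg.2 (hVW i r)
    have h5 : ∑ i, ∫ r, (W i r - V i r) ∂P ≤ D * (ε / 4) := by
      refine (Finset.sum_le_sum fun i _ => hbias i).trans ?_
      rw [Finset.sum_const, Finset.card_univ, nsmul_eq_mul]
      have : δ ^ 2 / 8 ≤ ε / 4 := by nlinarith
      exact mul_le_mul_of_nonneg_left this hD0.le
    rw [hdec] at hx
    obtain ⟨h6, h7⟩ := abs_lt.1 h1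
    rcases lt_abs.1 hx with h | h <;> linarith
  refine (measureReal_mono hsub).trans ((measureReal_union_le _ _).trans ?_)
  have : 2 * δ ^ 2 ≤ δ / 2 := by nlinarith
  linarith

end Concentration

/-! ### The kernel as a characteristic function -/

section Kernel

variable {d : ℕ} {K : EuclideanSpace ℝ (Fin d) → EuclideanSpace ℝ (Fin d) → ℝ}

theorem IsShiftInvariant.apply_sub (h : IsShiftInvariant K) (x y : EuclideanSpace ℝ (Fin d)) :
    K (x - y) 0 = K x y := by
  obtain ⟨k, hk⟩ := h
  rw [hk, hk, sub_zero]

theorem IsShiftInvariant.apply_self (h : IsShiftInvariant K) (x : EuclideanSpace ℝ (Fin d)) :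
    K x x = K 0 0 := by
  rw [← h.apply_sub x x, sub_self]

section FeatureMap

variable {H : Type*} [NormedAddCommGroup H] [InnerProductSpace ℝ H]
  {φ : EuclideanSpace ℝ (Fin d) → H}

theorem IsFeatureMap.sq_dist (h : IsFeatureMap K φ) (hs : IsShiftInvariant K)
    (x y : EuclideanSpace ℝ (Fin d)) :
    dist (φ x) (φ y) ^ 2 = 2 * (K 0 0 - K (x - y) 0) := by
  rw [dist_eq_norm, norm_sub_sq_real, ← real_inner_self_eq_norm_sq, ← real_inner_self_eq_norm_sq,
    h, h, h, hs.apply_self x, hs.apply_self y, hs.apply_sub]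
  ring

theorem IsFeatureMap.continuous (h : IsFeatureMap K φ) (hs : IsShiftInvariant K)
    (hc : ContinuousAt (fun z => K z 0) 0) : Continuous φ := by
  rw [continuous_iff_continuousAt]
  intro x
  rw [ContinuousAt, tendsto_iff_dist_tendsto_zero]
  have h1 : Filter.Tendsto (fun y => √(2 * (K 0 0 - K (y - x) 0))) (nhds x) (nhds 0) := by
    have h2 : Filter.Tendsto (fun y => y - x) (nhds x) (nhds 0) := by
      have : Continuous fun y : EuclideanSpace ℝ (Fin d) => y - x := by fun_prop
      simpa using this.tendsto x
    have h3 := ((hc.tendsto.comp h2).const_sub (K 0 0)).const_mul 2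
    have h4 := (Real.continuous_sqrt.tendsto _).comp h3
    simpa [Function.comp_def] using h4
  refine h1.congr fun y => ?_
  rw [← h.sq_dist hs, Real.sqrt_sq dist_nonneg]

/-- Regularity is assumed only near the origin; positive definiteness, through φ, spreads continuity
to all of ℝ^d. This upgrades the distributional Fourier identity to a pointwise one. -/
theorem IsFeatureMap.continuous_kernel (h : IsFeatureMap K φ) (hs : IsShiftInvariant K)
    (hc : ContinuousAt (fun z => K z 0) 0) : Continuous fun z => K z 0 := by
  have := h.continuous hs hc
  have e : (fun z => K z 0) = fun z => inner ℝ (φ z) (φ 0) := funext fun z => (h z 0).symm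
  rw [e]
  fun_prop

end FeatureMap

open scoped FourierTransform SchwartzMap

/-- `fourierInt` has no 2π in its exponent, hence the dilation. -/
theorem fourierInt_fourierInv (g : 𝓢(EuclideanSpace ℝ (Fin d), ℂ))
    (x : EuclideanSpace ℝ (Fin d)) :
    fourierInt (𝓕⁻ g : 𝓢(EuclideanSpace ℝ (Fin d), ℂ)) x = g ((2 * Real.pi)⁻¹ • x) := by
  have h : 𝓕 (𝓕⁻ g : 𝓢(EuclideanSpace ℝ (Fin d), ℂ)) = g := FourierTransform.fourier_fourierInv_eq g
  conv_rhs => rw [← h]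
  rw [ SchwartzMap.fourier_coe, Real.fourier_eq', fourierInt]
  refine integral_congr_ae (ae_of_all _ fun v => ?_)
  simp only [smul_eq_mul, inner_smul_right]
  rw [mul_comm]
  congr 2
  push_cast
  field_simp

/-- Fubini: the Fourier transform moves from the test function onto μ. -/
theorem integral_fourierInv_eq_integral_mul_charFun
    (μ : Measure (EuclideanSpace ℝ (Fin d))) [IsFiniteMeasure μ]
    (g : 𝓢(EuclideanSpace ℝ (Fin d), ℂ)) :
    ∫ ω, (𝓕⁻ g : 𝓢(EuclideanSpace ℝ (Fin d), ℂ)) ω ∂μ =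
      ∫ v, g v * charFun μ ((2 * Real.pi) • v) := by
  have h := VectorFourier.integral_fourierIntegral_smul_eq_flip (μ := volume) (ν := μ)
    (L := -innerₗ (EuclideanSpace ℝ (Fin d))) (f := g) (g := fun _ => (1 : ℂ))
    Real.continuous_fourierChar (by
      have : Continuous fun p : EuclideanSpace ℝ (Fin d) × EuclideanSpace ℝ (Fin d) =>
        -(inner ℝ p.1 p.2 : ℝ) := by fun_prop
      simpa using this) g.integrable (integrable_const 1)
  refine Eq.trans ?_ (h.trans ?_)
  · refine integral_congr_ae (ae_of_all _ fun v => ?_)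
    simp [SchwartzMap.fourierInv_coe, Real.fourierInv_eq, VectorFourier.fourierIntegral]
  · refine integral_congr_ae (ae_of_all _ fun v => ?_)
    simp only [smul_eq_mul, VectorFourier.fourierIntegral, charFun_apply]
    congr 1
    refine integral_congr_ae (ae_of_all _ fun w => ?_)
    simp [Real.fourierChar_apply, Circle.smul_def, inner_smul_right, real_inner_comm]

/-- The characteristic function of the spectral distribution is the normalized kernel. -/
theorem IsSpectralDistribution.charFun_eq {μ : Measure (EuclideanSpace ℝ (Fin d))}
    [IsFiniteMeasure μ] (h : IsSpectralDistribution K μ) (hc : Continuous fun z => K z 0)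
    (z : EuclideanSpace ℝ (Fin d)) : charFun μ z = ((K z 0 / K 0 0 : ℝ) : ℂ) := by
  set f₁ : EuclideanSpace ℝ (Fin d) → ℂ := fun v => charFun μ ((2 * Real.pi) • v) with hf₁
  set f₂ : EuclideanSpace ℝ (Fin d) → ℂ :=
    fun v => ((K ((2 * Real.pi) • v) 0 / K 0 0 : ℝ) : ℂ) with hf₂
  have hπ : (2 * Real.pi) ≠ 0 := by positivity
  have c₁ : Continuous f₁ := continuous_charFun.comp (continuous_const_smul _)
  have c₂ : Continuous f₂ := Complex.continuous_ofReal.comp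
    ((hc.comp (continuous_const_smul (2 * Real.pi))).div_const _)
  -- Testing the spectral identity against 𝓕⁻ g leaves g itself on both sides; substituting x = 2πv
  -- cancels (2π)^(-d).
  have hS : ∀ g : 𝓢(EuclideanSpace ℝ (Fin d), ℂ), ∫ v, g v * f₁ v = ∫ v, g v * f₂ v := by
    intro g
    rw [← integral_fourierInv_eq_integral_mul_charFun, h.fourier]
    simp only [fourierInt_fourierInv]
    have e := Measure.integral_comp_smul (volume : Measure (EuclideanSpace ℝ (Fin d)))
      (fun x => ((K x 0 / K 0 0 : ℝ) : ℂ) * g ((2 * Real.pi)⁻¹ • x)) (2 * Real.pi)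
    rw [finrank_euclideanSpace_fin, abs_of_pos (by positivity), Complex.real_smul] at e
    rw [← Complex.ofReal_inv, ← e]
    refine integral_congr_ae (ae_of_all _ fun v => ?_)
    simp only [hf₂, inv_smul_smul₀ hπ]
    rw [mul_comm]
  have hae : ∀ᵐ x, f₁ x = f₂ x := by
    refine ae_eq_of_integral_contDiff_smul_eq c₁.locallyIntegrable c₂.locallyIntegrable ?_
    intro g g_smooth g_cpt
    have hg₁ : HasCompactSupport (Complex.ofRealCLM ∘ g) := g_cpt.comp_left rfl
    have hg₂ : ContDiff ℝ (⊤ : ℕ∞) (Complex.ofRealCLM ∘ g) := by fun_prop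
    simpa using hS (hg₁.toSchwartzMap hg₂)
  have heq := Continuous.ae_eq_iff_eq volume c₁ c₂ |>.1 hae
  have := congrFun heq ((2 * Real.pi)⁻¹ • z)
  simpa only [hf₁, hf₂, smul_inv_smul₀ hπ] using this

end Kernel

/-! ### Central differences and Taylor coefficients -/

section CentralDifference

open Filter Topology Asymptotics

/-- Real part of the binomial expansion of (exp(iθ/2) - exp(-iθ/2))^(2n). With θ = uY, integration
turns the right side into a central difference of t ↦ ∫ cos(tY). -/
theorem two_mul_sin_half_pow (n : ℕ) (θ : ℝ) :
    (2 * Real.sin (θ / 2)) ^ (2 * n) = (-1) ^ n * ∑ k ∈ Finset.range (2 * n + 1),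
      ((-1 : ℤ) ^ (2 * n - k) * (2 * n).choose k) • Real.cos ((-n + k) * θ) := by
  have hc : ((2 * Real.sin (θ / 2) : ℝ) : ℂ) ^ (2 * n) =
      (-1) ^ n * ∑ k ∈ Finset.range (2 * n + 1),
      ((-1 : ℤ) ^ (2 * n - k) * (2 * n).choose k) • Complex.exp (((-n + k) * θ : ℝ) * Complex.I) := by
    have h1 : Complex.exp ((θ / 2 : ℝ) * Complex.I) + -Complex.exp (-(θ / 2 : ℝ) * Complex.I) =
        Complex.I * (2 * Real.sin (θ / 2) : ℝ) := by
      push_cast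
      rw [Complex.exp_mul_I, Complex.exp_mul_I, Complex.cos_neg, Complex.sin_neg]
      ring
    have h2 := congrArg (· ^ (2 * n)) h1
    simp only [mul_pow, pow_mul, Complex.I_sq] at h2
    rw [← pow_mul, ← pow_mul, add_pow] at h2
    have h3 : ((-1 : ℂ) ^ n) * (-1) ^ n = 1 := by rw [← mul_pow]; simp
    have h4 : ((2 * Real.sin (θ / 2) : ℝ) : ℂ) ^ (2 * n) =
        (-1) ^ n * ((-1) ^ n * ((2 * Real.sin (θ / 2) : ℝ) : ℂ) ^ (2 * n)) := by
      rw [← mul_assoc, h3, one_mul]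
    rw [h4, ← h2]
    congr 1
    refine Finset.sum_congr rfl fun k hk => ?_
    have hk' : k ≤ 2 * n := Nat.lt_succ_iff.1 (Finset.mem_range.1 hk)
    rw [neg_pow, ← Complex.exp_nat_mul, ← Complex.exp_nat_mul, zsmul_eq_mul]
    have h4 : Complex.exp (((-n + k) * θ : ℝ) * Complex.I) =
        Complex.exp (k * ((θ / 2 : ℝ) * Complex.I)) *
          Complex.exp ((2 * n - k : ℕ) * (-(θ / 2 : ℝ) * Complex.I)) := by
      rw [← Complex.exp_add]
      congr 1
      push_cast [Nat.cast_sub hk']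
      ring
    rw [h4]
    push_cast
    ring
  apply Complex.ofReal_injective
  have hre := congrArg Complex.re hc
  rw [← Complex.ofReal_pow, Complex.ofReal_re] at hre
  rw [Complex.ofReal_inj, hre]
  have h5 : ((-1 : ℂ) ^ n) = (((-1 : ℝ) ^ n : ℝ) : ℂ) := by push_cast; rfl
  rw [h5, Complex.re_ofReal_mul, Complex.re_sum]
  congr 1
  refine Finset.sum_congr rfl fun k _ => ?_
  rw [zsmul_eq_mul, zsmul_eq_mul]
  have h6 : (((-1 : ℤ) ^ (2 * n - k) * (2 * n).choose k : ℤ) : ℂ) =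
    ((((-1 : ℤ) ^ (2 * n - k) * (2 * n).choose k : ℤ) : ℝ) : ℂ) := by push_cast; rfl
  rw [h6, Complex.re_ofReal_mul, Complex.exp_ofReal_mul_I_re]

/-- Finite differences of a function with a Taylor expansion, divided by the power of the step,
converge to the factorial times the Taylor coefficient. -/
theorem tendsto_sum_choose_div_pow {f : ℝ → ℝ} {p : FormalMultilinearSeries ℝ ℝ ℝ}
    (hf : HasFPowerSeriesAt f p 0) (N : ℕ) (y : ℝ) :
    Tendsto (fun h : ℝ => (∑ k ∈ Finset.range (N + 1),
      ((-1 : ℤ) ^ (N - k) * N.choose k) • f ((y + k) * h)) / h ^ N) (𝓝[≠] 0)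
      (𝓝 (N.factorial * p.coeff N)) := by
  set c : ℕ → ℤ := fun k => (-1 : ℤ) ^ (N - k) * N.choose k with hc
  -- `partialSum (N + 1)` keeps the degrees up to N, so the remainder is O(h^(N+1)) and vanishes
  -- after division by h^N.
  have hO := hf.isBigO_sub_partialSum_pow (N + 1)
  simp only [zero_add] at hO
  have hpoly : ∀ h : ℝ, ∑ k ∈ Finset.range (N + 1), c k • p.partialSum (N + 1) ((y + k) * h) =
      N.factorial * p.coeff N * h ^ N := by
    intro h
    -- The N-th difference kills degrees below N and sends x^N to N!.
    set Q : ℝ → ℝ := (fun x => ∑ j ∈ Finset.range N, (p.coeff j * h ^ j) * x ^ j) +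
      (p.coeff N * h ^ N) • fun x => x ^ N with hQ
    have h1 := fwdDiff_iter_eq_sum_shift (1 : ℝ) Q N y
    rw [hQ, fwdDiff_iter_add, fwdDiff_iter_sum_mul_pow_eq_zero, fwdDiff_iter_const_smul,
      fwdDiff_iter_eq_factorial] at h1
    have h2 : (N.factorial * p.coeff N * h ^ N) =
        ((0 : ℝ → ℝ) + (p.coeff N * h ^ N) • ((N.factorial : ℕ) : ℝ → ℝ)) y := by
      simp; ring
    rw [h2, h1]
    refine Finset.sum_congr rfl fun k _ => ?_
    simp only [hc, FormalMultilinearSeries.partialSum, FormalMultilinearSeries.apply_eq_pow_smul_coeff,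
      Finset.sum_range_succ, Pi.add_apply, Pi.smul_apply, smul_eq_mul, nsmul_eq_mul, mul_one]
    congr 2
    · exact Finset.sum_congr rfl fun j _ => by rw [mul_pow]; ring
    · rw [mul_pow]; ring
  have hrem : (fun h : ℝ => ∑ k ∈ Finset.range (N + 1), c k •
      (f ((y + k) * h) - p.partialSum (N + 1) ((y + k) * h))) =O[𝓝 0] fun h => h ^ (N + 1) := by
    suffices h : ∀ k ∈ Finset.range (N + 1), (fun h : ℝ => c k •
        (f ((y + k) * h) - p.partialSum (N + 1) ((y + k) * h))) =O[𝓝 0] fun h => h ^ (N + 1) by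
      simpa only [Finset.sum_fn] using IsBigO.sum h
    intro k _
    have ht : Tendsto (fun h : ℝ => (y + k) * h) (𝓝 0) (𝓝 0) := by
      have : Continuous fun h : ℝ => (y + k) * h := by fun_prop
      simpa using this.tendsto 0
    have h1 := (hO.comp_tendsto ht)
    have h2 : (fun h : ℝ => ‖(y + k) * h‖ ^ (N + 1)) =O[𝓝 0] fun h : ℝ => h ^ (N + 1) := by
      refine IsBigO.of_bound (|y + k| ^ (N + 1)) (Eventually.of_forall fun h => ?_)
      simp [mul_pow]
    simp only [zsmul_eq_mul]
    exact (h1.trans h2).const_mul_left _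
  have hdiv : Tendsto (fun h : ℝ => (∑ k ∈ Finset.range (N + 1), c k •
      (f ((y + k) * h) - p.partialSum (N + 1) ((y + k) * h))) / h ^ N) (𝓝[≠] 0) (𝓝 0) := by
    have h1 : (fun h : ℝ => h ^ (N + 1)) =o[𝓝 0] fun h : ℝ => h ^ N :=
      isLittleO_pow_pow (Nat.lt_succ_self N)
    exact ((hrem.trans_isLittleO h1).mono nhdsWithin_le_nhds).tendsto_div_nhds_zero
  have := hdiv.add_const (N.factorial * p.coeff N)
  rw [zero_add] at this
  refine this.congr' ?_
  filter_upwards [self_mem_nhdsWithin] with h hh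
  have hh' : h ^ N ≠ 0 := pow_ne_zero _ hh
  rw [div_add' _ _ _ hh', ← hpoly h, ← Finset.sum_add_distrib]
  congr 1
  refine Finset.sum_congr rfl fun k _ => ?_
  rw [smul_sub, sub_add_cancel]

end CentralDifference

/-! ### Exponential moments from analyticity -/

section ExponentialMoments

open Filter Topology

variable {E : Type*} [MeasurableSpace E] {ν : Measure E} [IsFiniteMeasure ν]

/-- The even moments are bounded by the Taylor coefficients of the characteristic function. -/
theorem lintegral_pow_le_of_hasFPowerSeriesAt {Y : E → ℝ} (hY : Measurable Y)
    {p : FormalMultilinearSeries ℝ ℝ ℝ}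
    (hp : HasFPowerSeriesAt (fun t : ℝ => ∫ x, Real.cos (t * Y x) ∂ν) p 0) (n : ℕ) :
    ∫⁻ x, ENNReal.ofReal (Y x ^ (2 * n)) ∂ν ≤
      ENNReal.ofReal ((2 * n).factorial * |p.coeff (2 * n)|) := by
  set u : ℕ → ℝ := fun m => 1 / ((m : ℝ) + 1) with hu
  have hu0 : Tendsto u atTop (𝓝[≠] 0) :=
    tendsto_nhdsWithin_iff.2 ⟨tendsto_one_div_add_atTop_nhds_zero_nat,
      Eventually.of_forall fun m => by simp only [hu]; exact (by positivity : (0 : ℝ) < _).ne'⟩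
  -- g m tends pointwise to Y^(2n), while its integral is a difference quotient tending to a Taylor
  -- coefficient up to (2n)! and sign. Fatou's lemma then bounds the moment without assuming it
  -- finite.
  set g : ℕ → E → ℝ := fun m x => (2 * Real.sin (u m * Y x / 2)) ^ (2 * n) / u m ^ (2 * n) with hg
  have hgm : ∀ m, Measurable (g m) := fun m => by simp only [hg]; fun_prop
  have hgi : ∀ m, ∫ x, g m x ∂ν = (-1) ^ n * ((∑ k ∈ Finset.range (2 * n + 1),
      ((-1 : ℤ) ^ (2 * n - k) * (2 * n).choose k) •
        ∫ x, Real.cos ((-n + k) * u m * Y x) ∂ν) / u m ^ (2 * n)) := by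
    intro m
    simp only [hg, two_mul_sin_half_pow]
    rw [integral_div, integral_const_mul, mul_div_assoc, integral_finsetSum]
    · congr 2
      refine Finset.sum_congr rfl fun k _ => ?_
      simp only [zsmul_eq_mul, mul_assoc]
      rw [integral_const_mul]
    · intro k _
      simp only [zsmul_eq_mul]
      refine Integrable.const_mul (f := fun x => Real.cos ((-n + k) * (u m * Y x))) ?_ _
      exact Integrable.of_mem_Icc (-1) 1 (by fun_prop)
        (ae_of_all _ fun x => ⟨Real.neg_one_le_cos _, Real.cos_le_one _⟩)
  have hlim : Tendsto (fun m => ∫ x, g m x ∂ν) atTop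
      (𝓝 ((-1) ^ n * ((2 * n).factorial * p.coeff (2 * n)))) := by
    simp only [hgi]
    exact ((tendsto_sum_choose_div_pow hp (2 * n) (-n)).comp hu0).const_mul _
  have hg0 : ∀ m x, 0 ≤ g m x := fun m x => by
    simp only [hg, pow_mul]; positivity
  have hgint : ∀ m, Integrable (g m) ν := fun m => by
    refine Integrable.of_mem_Icc 0 (2 ^ (2 * n) / u m ^ (2 * n)) (hgm m).aemeasurable
      (ae_of_all _ fun x => ⟨hg0 m x, ?_⟩)
    have hum : 0 < u m := by simp only [hu]; positivity
    simp only [hg]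
    refine div_le_div_of_nonneg_right ?_ (by positivity)
    rw [← Even.pow_abs (even_two_mul n) (2 * Real.sin _)]
    refine pow_le_pow_left₀ (abs_nonneg _) ?_ _
    rw [abs_mul, abs_two]
    linarith [Real.abs_sin_le_one (u m * Y x / 2)]
  have hpt : ∀ x, Tendsto (fun m => g m x) atTop (𝓝 (Y x ^ (2 * n))) := by
    intro x
    have h1 : HasDerivAt (fun h : ℝ => 2 * Real.sin (h * Y x / 2)) (Y x) 0 := by
      have h2 : HasDerivAt (fun h : ℝ => h * Y x / 2) (1 * Y x / 2) 0 :=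
        ((hasDerivAt_id (0 : ℝ)).mul_const (Y x)).div_const 2
      have h3 := (h2.sin).const_mul 2
      convert! h3 using 1
      simp; ring
    have h4 := (hasDerivAt_iff_tendsto_slope_zero.1 h1).comp hu0
    have h5 := h4.pow (2 * n)
    refine h5.congr fun m => ?_
    simp only [Function.comp, hg, zero_add, zero_mul, zero_div, Real.sin_zero, mul_zero, sub_zero,
      smul_eq_mul]
    rw [inv_mul_eq_div, div_pow]
  calc ∫⁻ x, ENNReal.ofReal (Y x ^ (2 * n)) ∂ν
      = ∫⁻ x, liminf (fun m => ENNReal.ofReal (g m x)) atTop ∂ν := by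
        refine lintegral_congr fun x => ?_
        exact (((ENNReal.continuous_ofReal.tendsto _).comp (hpt x)).liminf_eq).symm
    _ ≤ liminf (fun m => ∫⁻ x, ENNReal.ofReal (g m x) ∂ν) atTop :=
        lintegral_liminf_le fun m => (hgm m).ennreal_ofReal
    _ = ENNReal.ofReal ((-1) ^ n * ((2 * n).factorial * p.coeff (2 * n))) := by
        refine Tendsto.liminf_eq ?_
        refine ((ENNReal.continuous_ofReal.tendsto _).comp hlim).congr fun m => ?_
        exact ofReal_integral_eq_lintegral_ofReal (hgint m) (ae_of_all _ (hg0 m))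
    _ ≤ _ := by
        refine ENNReal.ofReal_le_ofReal ((le_abs_self _).trans (le_of_eq ?_))
        simp [abs_mul]

/-- A random variable whose characteristic function is analytic at the origin has exponential
moments. -/
theorem eventually_integrable_exp_mul_abs {Y : E → ℝ} (hY : Measurable Y)
    (ha : AnalyticAt ℝ (fun t : ℝ => ∫ x, Real.cos (t * Y x) ∂ν) 0) :
    ∀ᶠ s in 𝓝[>] (0 : ℝ), Integrable (fun x => Real.exp (s * |Y x|)) ν := by
  obtain ⟨p, hp⟩ := ha
  obtain ⟨C, r, hC, hr, hCr⟩ := p.le_mul_pow_of_radius_pos hp.radius_pos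
  filter_upwards [Ioo_mem_nhdsGT (show 0 < 1 / r by positivity)] with s hs
  obtain ⟨hs0, hs1⟩ := hs
  have hsr : s * r < 1 := by rwa [lt_div_iff₀ hr] at hs1
  -- The cosh series uses only even moments. Its factorials cancel those of the moment bound,
  -- leaving a geometric series of ratio (s * r)².
  have hcosh : ∀ x, ENNReal.ofReal (Real.cosh (s * Y x)) =
      ∑' n : ℕ, ENNReal.ofReal (s ^ (2 * n) / (2 * n).factorial) * ENNReal.ofReal (Y x ^ (2 * n)) := by
    intro x
    have h := Real.hasSum_cosh (s * Y x)
    rw [← h.tsum_eq, ENNReal.ofReal_tsum_of_nonneg (fun n => by rw [pow_mul]; positivity) h.summable]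
    refine tsum_congr fun n => ?_
    rw [← ENNReal.ofReal_mul (by positivity), mul_pow]
    congr 1; ring
  have hfin : ∫⁻ x, ENNReal.ofReal (Real.cosh (s * Y x)) ∂ν < ∞ := by
    simp only [hcosh]
    rw [lintegral_tsum fun n => ((hY.pow_const _).ennreal_ofReal.const_mul _).aemeasurable]
    have hle : ∀ n : ℕ, ∫⁻ x, ENNReal.ofReal (s ^ (2 * n) / (2 * n).factorial) *
        ENNReal.ofReal (Y x ^ (2 * n)) ∂ν ≤ ENNReal.ofReal (C * ((s * r) ^ 2) ^ n) := by
      intro n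
      rw [lintegral_const_mul _ (hY.pow_const _).ennreal_ofReal]
      have h1 : |p.coeff (2 * n)| ≤ C * r ^ (2 * n) := by
        rw [← Real.norm_eq_abs, ← FormalMultilinearSeries.norm_apply_eq_norm_coef]
        exact hCr (2 * n)
      calc _ ≤ ENNReal.ofReal (s ^ (2 * n) / (2 * n).factorial) *
            ENNReal.ofReal ((2 * n).factorial * (C * r ^ (2 * n))) := by
            gcongr
            refine (lintegral_pow_le_of_hasFPowerSeriesAt hY hp n).trans ?_
            gcongr
        _ = _ := by
            rw [← ENNReal.ofReal_mul (by positivity)]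
            congr 1
            have : ((2 * n).factorial : ℝ) ≠ 0 := by positivity
            field_simp
            ring
    refine (ENNReal.tsum_le_tsum hle).trans_lt ?_
    have hsum : Summable fun n : ℕ => C * ((s * r) ^ 2) ^ n :=
      (summable_geometric_of_lt_one (by positivity)
        (pow_lt_one₀ (by positivity) hsr two_ne_zero)).mul_left C
    rw [← ENNReal.ofReal_tsum_of_nonneg (fun n => by positivity) hsum]
    exact ENNReal.ofReal_lt_top
  have hint : Integrable (fun x => Real.cosh (s * Y x)) ν := by
    refine ⟨by fun_prop, ?_⟩
    rw [hasFiniteIntegral_iff_ofReal (ae_of_all _ fun x => (Real.cosh_pos _).le)]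
    exact hfin
  refine (hint.const_mul 2).mono' (by fun_prop) (ae_of_all _ fun x => ?_)
  rw [Real.norm_eq_abs, Real.abs_exp, ← Real.cosh_abs, abs_mul, abs_of_pos hs0, Real.cosh_eq]
  linarith [Real.exp_pos (-(s * |Y x|))]

end ExponentialMoments

/-! ### Lower bound on m(z) and uniform moments -/

section SpectralGap

open Filter Topology
open scoped RealInnerProductSpace

variable {E : Type*} [NormedAddCommGroup E] [InnerProductSpace ℝ E] [FiniteDimensional ℝ E]
  [MeasurableSpace E] [BorelSpace E] {μ : Measure E}

/-- **Riemann-Lebesgue lemma** for the characteristic function of an absolutely continuous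
measure. -/
theorem tendsto_charFun_cocompact [IsFiniteMeasure μ] (hμ : μ ≪ volume) :
    Tendsto (charFun μ) (cocompact E) (𝓝 0) := by
  have hc : -(2 * Real.pi)⁻¹ ≠ 0 := by
    have := Real.pi_pos
    exact neg_ne_zero.2 (by positivity)
  have h1 := (tendsto_integral_exp_inner_smul_cocompact
    (fun v : E => ((μ.rnDeriv volume v).toReal : ℂ))).comp
    (Homeomorph.smulOfNeZero (α := E) _ hc).isClosedEmbedding.tendsto_cocompact
  refine h1.congr fun z => ?_
  simp only [Function.comp, Homeomorph.smulOfNeZero_apply]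
  rw [charFun_apply, ← integral_rnDeriv_smul hμ]
  refine integral_congr_ae (ae_of_all _ fun v => ?_)
  simp only [inner_smul_right, Circle.smul_def, Real.fourierChar_apply, smul_eq_mul,
    Complex.real_smul]
  rw [mul_comm]
  congr 2
  have := Real.pi_pos.ne'
  push_cast
  field_simp

theorem integrable_cos_inner [IsFiniteMeasure μ] (z : E) :
    Integrable (fun ω => Real.cos ⟪ω, z⟫) μ :=
  Integrable.of_mem_Icc (-1) 1 (by fun_prop)
    (ae_of_all _ fun _ => ⟨Real.neg_one_le_cos _, Real.cos_le_one _⟩)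

theorem re_charFun_eq_integral_cos [IsFiniteMeasure μ] (z : E) :
    (charFun μ z).re = ∫ ω, Real.cos ⟪ω, z⟫ ∂μ := by
  have hi : Integrable (fun ω => Complex.exp (⟪ω, z⟫ * Complex.I)) μ :=
    Integrable.of_bound (by fun_prop) 1 (ae_of_all _ fun ω => by
      rw [Complex.norm_exp_ofReal_mul_I])
  rw [charFun_apply]
  refine (integral_re hi).symm.trans (integral_congr_ae (ae_of_all _ fun ω => ?_))
  exact Complex.exp_ofReal_mul_I_re _

/-- Pointwise, 1 - cos 2θ = 2(1 - cos θ)(1 + cos θ) ≤ 4(1 - cos θ). -/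
theorem integral_one_sub_cos_two_smul_le [IsFiniteMeasure μ] (z : E) :
    ∫ ω, (1 - Real.cos ⟪ω, (2 : ℝ) • z⟫) ∂μ ≤ 4 * ∫ ω, (1 - Real.cos ⟪ω, z⟫) ∂μ := by
  rw [← integral_const_mul]
  refine integral_mono ((integrable_const 1).sub (integrable_cos_inner _))
    (((integrable_const 1).sub (integrable_cos_inner _)).const_mul _) fun ω => ?_
  simp only [inner_smul_right, Real.cos_two_mul]
  nlinarith [sq_nonneg (1 - Real.cos ⟪ω, z⟫)]

theorem integral_one_sub_cos_two_pow_smul_le [IsFiniteMeasure μ] (n : ℕ) (z : E) :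
    ∫ ω, (1 - Real.cos ⟪ω, (2 : ℝ) ^ n • z⟫) ∂μ ≤ 4 ^ n * ∫ ω, (1 - Real.cos ⟪ω, z⟫) ∂μ := by
  induction n with
  | zero => simp
  | succ n ih =>
    rw [pow_succ', mul_smul]
    refine (integral_one_sub_cos_two_smul_le _).trans ?_
    rw [pow_succ', mul_assoc]
    gcongr

/-- For an absolutely continuous probability measure, `1 - Re (charFun μ z)` is bounded below by a
multiple of `min 1 ‖z‖ ^ 2`. -/
theorem exists_min_le_integral_one_sub_cos [IsProbabilityMeasure μ] (hμ : μ ≪ volume) :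
    ∃ R > (0 : ℝ), ∀ z : E,
      min (1 / 2) (‖z‖ ^ 2 / (8 * R ^ 2)) ≤ ∫ ω, (1 - Real.cos ⟪ω, z⟫) ∂μ := by
  have hm : ∀ z, ∫ ω, (1 - Real.cos ⟪ω, z⟫) ∂μ = 1 - (charFun μ z).re := fun z => by
    rw [integral_sub (integrable_const 1) (integrable_cos_inner _), re_charFun_eq_integral_cos]
    simp
  have hev : ∀ᶠ z in cocompact E, 1 / 2 ≤ ∫ ω, (1 - Real.cos ⟪ω, z⟫) ∂μ := by
    have h1 := Metric.tendsto_nhds.1 (tendsto_charFun_cocompact hμ) (1 / 2) (by norm_num)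
    filter_upwards [h1] with z hz
    rw [dist_zero_right] at hz
    rw [hm]
    linarith [Complex.re_le_norm (charFun μ z)]
  rw [← Metric.cobounded_eq_cocompact, ← comap_norm_atTop, eventually_comap,
    eventually_atTop] at hev
  obtain ⟨R₀, hR₀⟩ := hev
  set R := max R₀ 1
  have hR : 0 < R := lt_of_lt_of_le one_pos (le_max_right _ _)
  have hbig : ∀ z : E, R ≤ ‖z‖ → 1 / 2 ≤ ∫ ω, (1 - Real.cos ⟪ω, z⟫) ∂μ := fun z hz =>
    hR₀ ‖z‖ ((le_max_left _ _).trans hz) z rfl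
  refine ⟨R, hR, fun z => ?_⟩
  rcases le_or_gt R ‖z‖ with hz | hz
  · exact (min_le_left _ _).trans (hbig z hz)
  rcases eq_or_ne z 0 with rfl | hz0
  · simp
  have hz1 : 0 < ‖z‖ := norm_pos_iff.2 hz0
  -- With 2^n ≤ R/‖z‖ < 2^(n+1), n + 1 doublings carry z beyond radius R and cost 4^(n+1) ≤
  -- 4(R/‖z‖)².
  obtain ⟨n, hn1, hn2⟩ := exists_nat_pow_near (x := R / ‖z‖) (y := 2)
    ((one_le_div hz1).2 hz.le) one_lt_two
  have h1 : 1 / 2 ≤ 4 ^ (n + 1) * ∫ ω, (1 - Real.cos ⟪ω, z⟫) ∂μ := by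
    refine (hbig ((2 : ℝ) ^ (n + 1) • z) ?_).trans (integral_one_sub_cos_two_pow_smul_le _ _)
    rw [norm_smul, norm_pow, Real.norm_two]
    exact ((div_lt_iff₀ hz1).1 hn2).le
  have h2 : (4 : ℝ) ^ (n + 1) ≤ 4 * (R / ‖z‖) ^ 2 := by
    rw [pow_succ', show (4 : ℝ) ^ n = (2 ^ n) ^ 2 by rw [← pow_mul, mul_comm, pow_mul]; norm_num]
    gcongr
  have h0 : 0 ≤ ∫ ω, (1 - Real.cos ⟪ω, z⟫) ∂μ :=
    integral_nonneg fun ω => sub_nonneg.2 (Real.cos_le_one _)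
  refine (min_le_right _ _).trans ?_
  have h3 := h1.trans (mul_le_mul_of_nonneg_right h2 h0)
  rw [div_le_iff₀ (by positivity)]
  rw [div_pow] at h3
  have h4 := mul_le_mul_of_nonneg_right h3 (by positivity : (0 : ℝ) ≤ 2 * ‖z‖ ^ 2)
  have h5 : 4 * (R ^ 2 / ‖z‖ ^ 2) * (∫ ω, (1 - Real.cos ⟪ω, z⟫) ∂μ) * (2 * ‖z‖ ^ 2) =
      (∫ ω, (1 - Real.cos ⟪ω, z⟫) ∂μ) * (8 * R ^ 2) := by
    field_simp; ring
  linarith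

/-- The normalized variables `(1 - cos ⟨ω, z⟩) / E (1 - cos ⟨ω, z⟩)` have uniformly bounded
stretched exponential moments if `‖ω‖` has an exponential moment. -/
theorem exists_integral_exp_sqrt_one_sub_cos_le [IsProbabilityMeasure μ] (hμ : μ ≪ volume)
    {s : ℝ} (hs : 0 < s) (hexp : Integrable (fun ω => Real.exp (s * ‖ω‖)) μ) :
    ∃ r > (0 : ℝ), ∃ M > (0 : ℝ), ∀ z : E, z ≠ 0 →
      0 < ∫ ω, (1 - Real.cos ⟪ω, z⟫) ∂μ ∧
      Integrable (fun ω => Real.exp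
        (r * √((1 - Real.cos ⟪ω, z⟫) / ∫ ω, (1 - Real.cos ⟪ω, z⟫) ∂μ))) μ ∧
      ∫ ω, Real.exp
        (r * √((1 - Real.cos ⟪ω, z⟫) / ∫ ω, (1 - Real.cos ⟪ω, z⟫) ∂μ)) ∂μ ≤ M := by
  obtain ⟨R, hR, hlow⟩ := exists_min_le_integral_one_sub_cos hμ
  have hI : 0 < ∫ ω, Real.exp (s * ‖ω‖) ∂μ := integral_exp_pos hexp
  refine ⟨s / (2 * R), by positivity, Real.exp (s / R) * ∫ ω, Real.exp (s * ‖ω‖) ∂μ,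
    by positivity, fun z hz => ?_⟩
  have hz0 : 0 < ‖z‖ := norm_pos_iff.2 hz
  have hm := hlow z
  set m := ∫ ω, (1 - Real.cos ⟪ω, z⟫) ∂μ
  have hm0 : 0 < m := lt_of_lt_of_le (lt_min (by norm_num) (by positivity)) hm
  -- If m ≥ 1/2 the ratio is at most 4; otherwise ‖z‖² cancels and leaves (2R‖ω‖)².
  have hW : ∀ ω : E, √((1 - Real.cos ⟪ω, z⟫) / m) ≤ 2 + 2 * R * ‖ω‖ := by
    intro ω
    refine Real.sqrt_le_iff.2 ⟨by positivity, ?_⟩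
    rw [div_le_iff₀ hm0]
    have hge : 0 ≤ ‖ω‖ := norm_nonneg ω
    rcases min_le_iff.1 hm with h | h
    · have h1 : (4 : ℝ) ≤ (2 + 2 * R * ‖ω‖) ^ 2 := by nlinarith [mul_nonneg hR.le hge]
      nlinarith [Real.neg_one_le_cos ⟪ω, z⟫]
    · have h1 : (2 * R * ‖ω‖) ^ 2 ≤ (2 + 2 * R * ‖ω‖) ^ 2 := by gcongr; linarith
      have h2 : 1 - Real.cos ⟪ω, z⟫ ≤ ⟪ω, z⟫ ^ 2 / 2 := by
        linarith [Real.one_sub_sq_div_two_le_cos (x := ⟪ω, z⟫)]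
      have h3 : ⟪ω, z⟫ ^ 2 ≤ (‖ω‖ * ‖z‖) ^ 2 := by
        rw [← sq_abs]
        exact pow_le_pow_left₀ (abs_nonneg _) (abs_real_inner_le_norm ω z) 2
      calc 1 - Real.cos ⟪ω, z⟫ ≤ (‖ω‖ * ‖z‖) ^ 2 / 2 := by linarith
        _ = (2 * R * ‖ω‖) ^ 2 * (‖z‖ ^ 2 / (8 * R ^ 2)) := by field_simp; norm_num
        _ ≤ (2 + 2 * R * ‖ω‖) ^ 2 * m := by gcongr
  have hle : ∀ ω : E, Real.exp (s / (2 * R) * √((1 - Real.cos ⟪ω, z⟫) / m)) ≤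
      Real.exp (s / R) * Real.exp (s * ‖ω‖) := by
    intro ω
    rw [← Real.exp_add, Real.exp_le_exp]
    calc s / (2 * R) * √((1 - Real.cos ⟪ω, z⟫) / m) ≤ s / (2 * R) * (2 + 2 * R * ‖ω‖) := by
          gcongr; exact hW ω
      _ = _ := by field_simp
  refine ⟨hm0, ?_, ?_⟩
  · refine (hexp.const_mul (Real.exp (s / R))).mono' (by fun_prop) (ae_of_all _ fun ω => ?_)
    rw [Real.norm_eq_abs, Real.abs_exp]
    exact hle ω
  · rw [← integral_const_mul]
    exact integral_mono_of_nonneg (ae_of_all _ fun ω => (Real.exp_pos _).le)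
      (hexp.const_mul _) (ae_of_all _ hle)

end SpectralGap

/-! ### From coordinates to the norm -/

section ExponentialMomentNorm

open Filter Topology

variable {d : ℕ}

/-- A finite measure on `ℝ^d` whose characteristic function has an analytic real part at the
origin has an exponential moment. -/
theorem exists_integrable_exp_mul_norm {μ : Measure (EuclideanSpace ℝ (Fin d))}
    [IsFiniteMeasure μ] (ha : AnalyticAt ℝ (fun z => (charFun μ z).re) 0) :
    ∃ s > (0 : ℝ), Integrable (fun ω => Real.exp (s * ‖ω‖)) μ := by
  have hj : ∀ j : Fin d, ∀ᶠ s in 𝓝[>] (0 : ℝ),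
      Integrable (fun ω : EuclideanSpace ℝ (Fin d) => Real.exp (s * |ω j|)) μ := by
    intro j
    refine eventually_integrable_exp_mul_abs (by fun_prop) ?_
    have hlin : AnalyticAt ℝ (fun t : ℝ => t • EuclideanSpace.single j (1 : ℝ)) 0 := by
      fun_prop
    refine (ha.comp_of_eq hlin (zero_smul ℝ _)).congr (Eventually.of_forall fun t => ?_)
    simp [re_charFun_eq_integral_cos, inner_smul_right, EuclideanSpace.inner_single_right]
  obtain ⟨s, hs, hs0⟩ := ((eventually_all.2 hj).and self_mem_nhdsWithin).exists
  have hs0 : 0 < s := hs0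
  -- The norm is at most (d + 1) times the largest coordinate; d + 1 keeps the divisor nonzero when
  -- d = 0.
  refine ⟨s / (d + 1), by positivity, ?_⟩
  have hdom : Integrable (fun ω : EuclideanSpace ℝ (Fin d) =>
      1 + ∑ j, Real.exp (s * |ω j|)) μ :=
    (integrable_const 1).add (integrable_finsetSum _ fun j _ => hs j)
  refine hdom.mono' (by fun_prop) (ae_of_all _ fun ω => ?_)
  rw [Real.norm_eq_abs, Real.abs_exp]
  have hsum : 0 ≤ ∑ j, Real.exp (s * |ω j|) := Finset.sum_nonneg fun j _ => (Real.exp_pos _).le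
  rcases isEmpty_or_nonempty (Fin d) with hd | hd
  · have : ω = 0 := Subsingleton.elim _ _
    simp [this]
  · obtain ⟨j, -, hj⟩ := Finset.exists_max_image Finset.univ (fun j => |ω j|)
      Finset.univ_nonempty
    have hnorm : ‖ω‖ ≤ (d + 1) * |ω j| := by
      rw [EuclideanSpace.norm_eq]
      refine Real.sqrt_le_iff.2 ⟨by positivity, ?_⟩
      calc ∑ i, ‖ω i‖ ^ 2 ≤ ∑ _i : Fin d, |ω j| ^ 2 :=
            Finset.sum_le_sum fun i hi => pow_le_pow_left₀ (norm_nonneg _) (hj i hi) 2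
        _ = d * |ω j| ^ 2 := by simp
        _ ≤ (d + 1) ^ 2 * |ω j| ^ 2 := by
            gcongr
            nlinarith [Nat.cast_nonneg (α := ℝ) d]
        _ = _ := by ring
    calc Real.exp (s / (d + 1) * ‖ω‖) ≤ Real.exp (s / (d + 1) * ((d + 1) * |ω j|)) := by gcongr
      _ = Real.exp (s * |ω j|) := by congr 1; field_simp
      _ ≤ ∑ j, Real.exp (s * |ω j|) :=
          Finset.single_le_sum (f := fun j => Real.exp (s * |ω j|))
            (fun j _ => (Real.exp_pos _).le) (Finset.mem_univ j)
      _ ≤ _ := by linarith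

end ExponentialMomentNorm

/-! ### Distances between random features, and assembly -/

theorem sq_dist_rffMap {d D : ℕ} {κ : ℝ} (hκ : 0 ≤ κ) (w : Fin D → EuclideanSpace ℝ (Fin d))
    (x y : EuclideanSpace ℝ (Fin d)) :
    dist (rffMap κ w x) (rffMap κ w y) ^ 2 =
      κ / D * ∑ i, 2 * (1 - Real.cos (inner ℝ (w i) (x - y))) := by
  rw [EuclideanSpace.dist_sq_eq, Fintype.sum_prod_type, Finset.mul_sum]
  refine Finset.sum_congr rfl fun i _ => ?_
  have h : √(κ / D) ^ 2 = κ / D := Real.sq_sqrt (by positivity)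
  simp only [rffMap, Fin.sum_univ_two, Real.dist_eq, sq_abs, if_true, one_ne_zero, if_false]
  rw [← mul_sub, ← mul_sub, mul_pow, mul_pow, h, ← mul_add, inner_sub_right, Real.cos_sub]
  congr 1
  linear_combination Real.sin_sq_add_cos_sq (inner ℝ (w i) x : ℝ) +
    Real.sin_sq_add_cos_sq (inner ℝ (w i) y : ℝ)

/-- Since a + b ≥ b, a relative error for squared distances passes to distances without loss. -/
theorem abs_sub_le_of_abs_sq_sub_sq_le {a b ε : ℝ} (ha : 0 ≤ a) (hb : 0 < b)
    (h : |a ^ 2 - b ^ 2| ≤ ε * b ^ 2) : |a - b| ≤ ε * b := by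
  have h1 : |a - b| * (a + b) = |a ^ 2 - b ^ 2| := by
    conv_lhs => rw [← abs_of_nonneg (add_nonneg ha hb.le), ← abs_mul]
    ring_nf
  have h2 : |a - b| * b ≤ |a - b| * (a + b) := by gcongr; linarith
  exact le_of_mul_le_mul_right (by linarith) hb

/-- The theorem for a fixed spectral measure μ, whose moments determine the constants. -/
theorem exists_le_prob_abs_dist_rffMap_sub_le {d : ℕ}
    {K : EuclideanSpace ℝ (Fin d) → EuclideanSpace ℝ (Fin d) → ℝ}
    (hshift : IsShiftInvariant K)
    (hanalytic : AnalyticAt ℝ (fun z : EuclideanSpace ℝ (Fin d) => K z 0) 0)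
    {μ : Measure (EuclideanSpace ℝ (Fin d))} [IsProbabilityMeasure μ] (hμ : μ ≪ volume)
    (hchar : ∀ z, charFun μ z = ((K z 0 / K 0 0 : ℝ) : ℂ)) :
    ∃ C₁ > (0 : ℝ), ∃ C₂ > (0 : ℝ),
      ∀ (H : Type*) [NormedAddCommGroup H] [InnerProductSpace ℝ H]
        (φ : EuclideanSpace ℝ (Fin d) → H), IsFeatureMap K φ →
      ∀ ε δ : ℝ, 0 < δ → δ ≤ ε → ε ≤ 1 / 2 ^ 16 →
      ∀ D : ℕ,
        max (C₁ * (ε⁻¹ * Real.log (1 / δ) ^ 3)) (C₂ * ((ε ^ 2)⁻¹ * Real.log (1 / δ))) ≤ (D : ℝ) →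
      ∀ (Ω : Type*) [MeasurableSpace Ω] (P : Measure Ω) [IsProbabilityMeasure P]
        (ω : Fin D → Ω → EuclideanSpace ℝ (Fin d)), iIndepFun ω P → (∀ i, HasLaw (ω i) μ P) →
      ∀ x y : EuclideanSpace ℝ (Fin d),
        1 - δ ≤ P.real {s | |dist (rffMap (K 0 0) (fun i => ω i s) x)
              (rffMap (K 0 0) (fun i => ω i s) y) - dist (φ x) (φ y)|
            ≤ ε * dist (φ x) (φ y)} := by
  have hre : ∀ z, (charFun μ z).re = K z 0 / K 0 0 := fun z => by
    rw [hchar, Complex.ofReal_re]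
  have hK0 : K 0 0 ≠ 0 := by
    intro h
    have := hre 0
    rw [h] at this
    simp at this
  have hm : ∀ z, ∫ ω, (1 - Real.cos (inner ℝ ω z)) ∂μ = 1 - K z 0 / K 0 0 := fun z => by
    rw [integral_sub (integrable_const 1) (integrable_cos_inner _), ← re_charFun_eq_integral_cos,
      hre]
    simp
  obtain ⟨s₀, hs₀, hexp₀⟩ := exists_integrable_exp_mul_norm (μ := μ) (by
    simp only [hre]
    exact hanalytic.div_const)
  obtain ⟨r, hr, M, hM, hmom⟩ := exists_integral_exp_sqrt_one_sub_cos_le hμ hs₀ hexp₀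
  -- The added 1 makes b nonnegative while exp b still dominates 64M/r².
  set b := Real.log (1 + 64 * M / r ^ 2) with hb
  have hq : 0 < 64 * M / r ^ 2 := by positivity
  have hb0 : 0 ≤ b := Real.log_nonneg (by linarith)
  have hbM : 64 * M / r ^ 2 ≤ Real.exp b := by
    rw [hb, Real.exp_log (by positivity)]; linarith
  refine ⟨8 * (2 * (2 + b) / r) ^ 2, by positivity, 32 * (24 / r ^ 4 * M), by positivity, ?_⟩
  intro H _ _ φ hφ ε δ hδ hδε hε D hD Ω _ P _ ω hind hlaw x y
  have hε0 : 0 < ε := hδ.trans_le hδε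
  have hκ : 0 < K 0 0 := lt_of_le_of_ne (by rw [← hφ 0 0]; exact real_inner_self_nonneg) hK0.symm
  rcases eq_or_ne x y with rfl | hxy
  · simp [hδ.le]
  obtain ⟨hm0, hint, hbound⟩ := hmom (x - y) (sub_ne_zero.2 hxy)
  set m := ∫ ω, (1 - Real.cos (inner ℝ ω (x - y))) ∂μ with hm_def
  set g : EuclideanSpace ℝ (Fin d) → ℝ := fun w => (1 - Real.cos (inner ℝ w (x - y))) / m with hg
  have hgm : Measurable g := by fun_prop
  have hD0 : (0 : ℝ) < D := by
    refine lt_of_lt_of_le ?_ ((le_max_left _ _).trans hD)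
    have : 0 < Real.log (1 / δ) := by
      refine Real.log_pos ((one_lt_div hδ).2 ?_)
      norm_num at hε
      linarith
    positivity
  have hcomp : ∀ (i : Fin D) (f : EuclideanSpace ℝ (Fin d) → ℝ), Measurable f →
      ∫ t, f (ω i t) ∂P = ∫ w, f w ∂μ := fun i f hf =>
    (hlaw i).integral_comp hf.aestronglyMeasurable
  have hconc := measure_abs_sum_sub_card_gt_le (P := P) (W := fun i t => g (ω i t)) hr hM hb0 hbM
    rfl rfl (hind.comp (fun _ => g) fun _ => hgm)
    (fun i => hgm.comp_aemeasurable (hlaw i).aemeasurable)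
    (fun i t => div_nonneg (sub_nonneg.2 (Real.cos_le_one _)) hm0.le)
    (fun i => by
      rw [hcomp i g hgm]
      simp only [hg]
      rw [integral_div, ← hm_def, div_self hm0.ne'])
    (fun i => by
      have h := hint
      rw [← (hlaw i).map_eq] at h
      exact h.comp_aemeasurable (hlaw i).aemeasurable)
    (fun i => by
      rw [hcomp i (fun w => Real.exp (r * √(g w))) (by fun_prop)]
      exact hbound)
    hδ hδε hε
    (by rw [Fintype.card_fin]; exact (le_max_left _ _).trans hD)
    (by rw [Fintype.card_fin]; exact (le_max_right _ _).trans hD)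
  rw [Fintype.card_fin] at hconc
  set bad := {t | D * ε < |∑ i, g (ω i t) - D|}
  set good := {t | |dist (rffMap (K 0 0) (fun i => ω i t) x)
    (rffMap (K 0 0) (fun i => ω i t) y) - dist (φ x) (φ y)| ≤ ε * dist (φ x) (φ y)}
  have hdφ : dist (φ x) (φ y) ^ 2 = 2 * K 0 0 * m := by
    rw [hφ.sq_dist hshift, hm_def, hm]
    field_simp
  have hcover : Set.univ ⊆ good ∪ bad := by
    intro t _
    by_cases hbad : t ∈ bad
    · exact Or.inr hbad
    refine Or.inl ?_
    have hle : |∑ i, g (ω i t) - D| ≤ D * ε := not_lt.1 hbad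
    refine abs_sub_le_of_abs_sq_sub_sq_le dist_nonneg ?_ ?_
    · refine lt_of_le_of_ne dist_nonneg fun h => ?_
      rw [← h] at hdφ
      have : 0 < 2 * K 0 0 * m := by positivity
      rw [← hdφ] at this
      simp at this
    · have hdπ : dist (rffMap (K 0 0) (fun i => ω i t) x) (rffMap (K 0 0) (fun i => ω i t) y) ^ 2 =
          dist (φ x) (φ y) ^ 2 * ((∑ i, g (ω i t)) / D) := by
        rw [sq_dist_rffMap hκ.le, hdφ]
        simp only [hg]
        rw [← Finset.mul_sum, ← Finset.sum_div]
        field_simp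
      have e : dist (φ x) (φ y) ^ 2 * ((∑ i, g (ω i t)) / D) - dist (φ x) (φ y) ^ 2 =
          dist (φ x) (φ y) ^ 2 * ((∑ i, g (ω i t) - D) / D) := by
        field_simp
      rw [hdπ, e, abs_mul, abs_div, abs_of_pos hD0, abs_of_nonneg (sq_nonneg _), mul_comm]
      gcongr
      rwa [div_le_iff₀ hD0, mul_comm]
  have h1 : (1 : ℝ) ≤ P.real good + P.real bad := by
    calc (1 : ℝ) = P.real Set.univ := probReal_univ.symm
      _ ≤ P.real (good ∪ bad) := measureReal_mono hcover
      _ ≤ _ := measureReal_union_le _ _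
  linarith

theorem theorem1p2 {d : ℕ}
    (K : EuclideanSpace ℝ (Fin d) → EuclideanSpace ℝ (Fin d) → ℝ)
    (hshift : IsShiftInvariant K)
    (hanalytic : AnalyticAt ℝ (fun z : EuclideanSpace ℝ (Fin d) => K z 0) 0) :
    ∃ C₁ > (0 : ℝ), ∃ C₂ > (0 : ℝ),
      ∀ (H : Type*) [NormedAddCommGroup H] [InnerProductSpace ℝ H]
        (φ : EuclideanSpace ℝ (Fin d) → H), IsFeatureMap K φ →
      ∀ ε δ : ℝ, 0 < δ → δ ≤ ε → ε ≤ 1 / 2 ^ 16 →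
      ∀ D : ℕ,
        max (C₁ * (ε⁻¹ * Real.log (1 / δ) ^ 3)) (C₂ * ((ε ^ 2)⁻¹ * Real.log (1 / δ))) ≤ (D : ℝ) →
      ∀ (Ω : Type*) [MeasurableSpace Ω] (P : Measure Ω) [IsProbabilityMeasure P]
        (ω : Fin D → Ω → EuclideanSpace ℝ (Fin d)), IsRFFSample K P ω →
      ∀ x y : EuclideanSpace ℝ (Fin d),
        1 - δ ≤ P.real {s | |dist (rffMap (K 0 0) (fun i => ω i s) x)
              (rffMap (K 0 0) (fun i => ω i s) y) - dist (φ x) (φ y)|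
            ≤ ε * dist (φ x) (φ y)} := by
  -- The constants must precede the sample, but the characteristic function depends on K alone and
  -- determines μ. If no such μ exists, no admissible sample does either. The dichotomy uses
  -- `charFun` because continuity of K, needed to derive the identity, is available only once φ is
  -- given.
  by_cases hex : ∃ μ : Measure (EuclideanSpace ℝ (Fin d)), IsProbabilityMeasure μ ∧ μ ≪ volume ∧
      ∀ z, charFun μ z = ((K z 0 / K 0 0 : ℝ) : ℂ)
  · obtain ⟨μ, hμp, hμ, hchar⟩ := hex
    obtain ⟨C₁, hC₁, C₂, hC₂, h⟩ :=
      exists_le_prob_abs_dist_rffMap_sub_le hshift hanalytic hμ hchar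
    refine ⟨C₁, hC₁, C₂, hC₂, ?_⟩
    intro H _ _ φ hφ ε δ hδ hδε hε D hD Ω _ P _ ω hω x y
    obtain ⟨μ', hμ', hlaw⟩ := hω.law
    refine h H φ hφ ε δ hδ hδε hε D hD Ω P ω hω.indep (fun i => ?_) x y
    have : IsProbabilityMeasure μ' := (hlaw i).isProbabilityMeasure_iff.1 ‹_›
    have hc := hφ.continuous_kernel hshift hanalytic.continuousAt
    rw [Measure.ext_of_charFun (μ := μ) (ν := μ')
      (funext fun z => by rw [hchar, hμ'.charFun_eq hc])]
    exact hlaw i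
  · refine ⟨1, one_pos, 1, one_pos, ?_⟩
    intro H _ _ φ hφ ε δ hδ hδε hε D hD Ω _ P _ ω hω x y
    have hc := hφ.continuous_kernel hshift hanalytic.continuousAt
    obtain ⟨μ, hμ, hlaw⟩ := hω.law
    -- An empty sample would not show that μ is a probability measure.
    have hD0 : 0 < D := by
      have hlog : 0 < Real.log (1 / δ) := by
        refine Real.log_pos ((one_lt_div hδ).2 ?_)
        norm_num at hε
        linarith
      have hε0 : 0 < ε := hδ.trans_le hδε
      have : (0 : ℝ) < D := lt_of_lt_of_le (by positivity) ((le_max_left _ _).trans hD)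
      exact_mod_cast this
    have : IsProbabilityMeasure μ := (hlaw ⟨0, hD0⟩).isProbabilityMeasure_iff.1 ‹_›
    exact absurd ⟨μ, this, hμ.absolutelyContinuous, hμ.charFun_eq hc⟩ hex
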